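/- All submeasures and measures are real-valued functions on Boolean algebras. A \emph{submeasure} on a Boolean algebra $\mathcal{A}$ is a monotone function $\phi\colon\mathcal{A}\to\mathbb{R}$ with $\phi(0)=0$ and $\phi(A\vee B)\le\phi(A)+\phi(B)$ for all $A,B\in\mathcal{A}$. A \emph{measure} on $\mathcal{A}$ is a monotone function $\mu\colon\mathcal{A}\to\mathbb{R}$ with $\mu(A\vee B)=\mu(A)+\mu(B)$ whenever $A\wedge B=0$; every measure is a submeasure. A submeasure $\phi$ is \emph{pathological} if there is no non-zero measure $\mu$ on $\mathcal{A}$ with $\mu\le\phi$. Let $G$ be a topological group (not necessarily Hausdorff) and $\phi$ a submeasure on $\mathcal{A}$. Let $S(\phi,G)$ be the set of all maps $a\colon G\to\mathcal{A}$ such that $\{g: a(g)\neq 0\}$ is finite, $\bigvee_{g\in G}a(g)=1$, and $a(g)\wedge a(h)=0$ for distinct $g,h\in G$. It is a group under $(ab)(g)=\bigvee\{a(x)\wedge b(y): xy=g\}$, and it carries the unique group topology for which the sets $\{a : \phi(\bigvee_{g\in G\setminus U}a(g))\le\varepsilon\}$, with $U$ an identity neighborhood in $G$ and $\varepsilon>0$,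 form a neighborhood basis at the identity. The topological group $L^0(\phi,G)$ is the Ra\u{\i}kov completion of $S(\phi,G)$, i.e., its Hausdorff completion with respect to the two-sided uniformity, with the group operations extended continuously. A \emph{length function} on a group $H$ is a function $f\colon H\to\mathbb{R}$ with $f(e)=0$, $f(x^{-1})=f(x)\ge 0$ and $f(xy)\le f(x)+f(y)$ for all $x,y\in H$. An \emph{escape function} on a topological group $H$ is a continuous length function $f$ on $H$ for which there is an identity neighborhood $U$ such that for every $\varepsilon>0$ there is $n\in\mathbb{N}$ with $\{g\in H : g^1,\dots,g^n\in U\}\subseteq f^{-1}([0,\varepsilon))$. The topological group $H$ has the \emph{escape property} if the sets $f^{-1}([0,1))$, with $f$ an escape function on $H$, form a neighborhood basis at the identity of $H$. \textbf{Theorem.} Let $G$ be a topological group, let $H$ be a topological group with the escape property, let $\phi$ be a pathological submeasure on a Boolean algebra, and let $\mu$ be a measure on a Boolean algebra. Then every continuous homomorphism $\pi\colon L^0(\phi,G)\to L^0(\mu,H)$ is trivial, that is, $\pi(x)=e$ for all $x\in L^0(\phi,G)$. -/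

import Mathlib

open Set Filter Topology

namespace LZero

universe u v

/-! ### Submeasures and measures on Boolean algebras -/

/-- A submeasure on a Boolean algebra: a monotone, subadditive real-valued function vanishing
at `⊥`. -/
structure Submeasure (A : Type u) [BooleanAlgebra A] where
  toFun : A → ℝ
  monotone : Monotone toFun
  subadditive : ∀ x y : A, toFun (x ⊔ y) ≤ toFun x + toFun y
  map_bot : toFun ⊥ = 0

instance {A : Type u} [BooleanAlgebra A] : CoeFun (Submeasure A) (fun _ => A → ℝ) :=
  ⟨Submeasure.toFun⟩

theorem Submeasure.nonneg {A : Type u} [BooleanAlgebra A] (φ : Submeasure A) (x : A) :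
    0 ≤ φ x := by
  have h := φ.monotone (bot_le : ⊥ ≤ x)
  rwa [φ.map_bot] at h

/-- A (finite, finitely additive) measure on a Boolean algebra: a monotone additive real-valued
function. -/
structure IsMeasure {A : Type u} [BooleanAlgebra A] (μ : A → ℝ) : Prop where
  monotone : Monotone μ
  additive : ∀ x y : A, x ⊓ y = ⊥ → μ (x ⊔ y) = μ x + μ y

/-- Every measure is a submeasure. -/
def IsMeasure.toSubmeasure {A : Type u} [BooleanAlgebra A] {μ : A → ℝ} (hμ : IsMeasure μ) :
    Submeasure A where
  toFun := μ
  monotone := hμ.monotone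
  subadditive := fun x y => by
    have h := hμ.additive x (y \ x) inf_sdiff_self_right
    rw [sup_sdiff_self_right] at h
    have h' := hμ.monotone (sdiff_le : y \ x ≤ y)
    linarith
  map_bot := by
    have h := hμ.additive ⊥ ⊥ (by simp)
    simp only [sup_idem] at h
    linarith

/-- A submeasure is pathological if the only measure below it is zero. -/
def Submeasure.IsPathological {A : Type u} [BooleanAlgebra A] (φ : Submeasure A) : Prop :=
  ¬ ∃ μ : A → ℝ, IsMeasure μ ∧ μ ≠ 0 ∧ ∀ x, μ x ≤ φ x

/-! ### The escape property -/

/-- Length functions on a group. -/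
structure IsLengthFunction {G : Type u} [Group G] (f : G → ℝ) : Prop where
  map_one : f 1 = 0
  map_inv : ∀ x, f x⁻¹ = f x
  nonneg : ∀ x, 0 ≤ f x
  map_mul_le : ∀ x y, f (x * y) ≤ f x + f y

/-- The set `(1/n) U` of all `g` with `g ^ 1, …, g ^ n ∈ U`. -/
def rootSet {G : Type u} [Group G] (n : ℕ) (U : Set G) : Set G :=
  {g | ∀ k : ℕ, 1 ≤ k → k ≤ n → g ^ k ∈ U}

/-- `U` is an escape neighborhood for `f`. -/
def IsEscapeNhd {G : Type u} [Group G] [TopologicalSpace G] (f : G → ℝ) (U : Set G) : Prop :=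
  U ∈ 𝓝 (1 : G) ∧ ∀ ε : ℝ, 0 < ε → ∃ n : ℕ, rootSet n U ⊆ f ⁻¹' Ico 0 ε

/-- Escape functions: continuous length functions that admit an escape neighborhood. -/
structure IsEscapeFunction {G : Type u} [Group G] [TopologicalSpace G] (f : G → ℝ) : Prop where
  continuous : Continuous f
  isLengthFunction : IsLengthFunction f
  exists_nhd : ∃ U : Set G, IsEscapeNhd f U

/-- The escape property: the sets `f ⁻¹' [0, 1)`, with `f` an escape function, form a neighborhood
basis at the identity. -/
def HasEscapeProperty (G : Type u) [Group G] [TopologicalSpace G] : Prop :=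
  (𝓝 (1 : G)).HasBasis (fun f : G → ℝ => IsEscapeFunction f) (fun f => f ⁻¹' Ico 0 1)

/-! ### Finite partitions of unity labeled by group elements -/

/-- A finite `G`-partition of unity in the Boolean algebra `A`. -/
@[ext]
structure FinPartition (A : Type u) [BooleanAlgebra A] (G : Type v) where
  toFun : G → A
  finite_support : {g | toFun g ≠ ⊥}.Finite
  isLUB_range : IsLUB (range toFun) ⊤
  disjoint : ∀ g h, g ≠ h → toFun g ⊓ toFun h = ⊥

namespace FinPartition

variable {A : Type u} [BooleanAlgebra A] {G : Type v}

instance : CoeFun (FinPartition A G) (fun _ => G → A) := ⟨FinPartition.toFun⟩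

/-- The finite set of labels with non-zero value. -/
noncomputable def support (a : FinPartition A G) : Finset G := a.finite_support.toFinset

theorem mem_support {a : FinPartition A G} {g : G} : g ∈ a.support ↔ a g ≠ ⊥ := by
  simp [support]

/-- The join `a[T]` of all `a g` with `g ∈ T`. -/
noncomputable def on (a : FinPartition A G) (T : Set G) : A :=
  open Classical in (a.support.filter (· ∈ T)).sup a

theorem le_on (a : FinPartition A G) {T : Set G} {g : G} (hg : g ∈ T) : a g ≤ a.on T := by
  classical
  by_cases h : a g = ⊥
  · simp [h]
  · exact Finset.le_sup (f := a.toFun) (Finset.mem_filter.2 ⟨mem_support.2 h, hg⟩)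

theorem on_le (a : FinPartition A G) {T : Set G} {z : A} (h : ∀ g ∈ T, a g ≤ z) :
    a.on T ≤ z := by
  classical
  exact Finset.sup_le fun g hg => h g (Finset.mem_filter.1 hg).2

/-- `a[T]` is the supremum of the `a g`, `g ∈ T`. -/
theorem isLUB_on (a : FinPartition A G) (T : Set G) : IsLUB (a '' T) (a.on T) := by
  refine ⟨?_, fun z hz => a.on_le fun g hg => hz ⟨g, hg, rfl⟩⟩
  rintro _ ⟨g, hg, rfl⟩
  exact a.le_on hg

theorem on_univ (a : FinPartition A G) : a.on univ = ⊤ := by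
  refine (a.isLUB_on univ).unique ?_
  simpa using a.isLUB_range

theorem le_of_forall (a : FinPartition A G) {x z : A} (h : ∀ g, x ⊓ a g ≤ z) : x ≤ z := by
  have : a.on univ ≤ x ⇨ z := a.on_le fun g _ => by
    rw [le_himp_iff, inf_comm]; exact h g
  rw [on_univ, top_le_iff, himp_eq_top_iff] at this
  exact this

/-- Two partitions with `a ≤ b` pointwise are equal. -/
theorem eq_of_le {a b : FinPartition A G} (h : ∀ g, a g ≤ b g) : a = b := by
  ext g
  refine le_antisymm (h g) (a.le_of_forall fun k => ?_)
  by_cases hk : g = k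
  · subst hk; exact inf_le_right
  · calc b g ⊓ a k ≤ b g ⊓ b k := inf_le_inf_left _ (h k)
      _ = ⊥ := b.disjoint _ _ hk
      _ ≤ _ := bot_le

variable [Group G]

/-- The value `⋁ h, a h ⊓ b (h⁻¹ * g)` of the product of two partitions. -/
noncomputable def mulFun (a b : FinPartition A G) (g : G) : A :=
  a.support.sup fun h => a h ⊓ b (h⁻¹ * g)

theorem le_mulFun (a b : FinPartition A G) (x y : G) : a x ⊓ b y ≤ mulFun a b (x * y) := by
  by_cases h : a x = ⊥
  · simp [h]
  · have := Finset.le_sup (f := fun h => a h ⊓ b (h⁻¹ * (x * y))) (mem_support.2 h)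
    simpa [mulFun] using this

theorem mulFun_le {a b : FinPartition A G} {g : G} {z : A}
    (h : ∀ x y, x * y = g → a x ⊓ b y ≤ z) : mulFun a b g ≤ z :=
  Finset.sup_le fun x _ => h x (x⁻¹ * g) (by simp)

/-- The product of partitions has the values `⋁ {a x ⊓ b y | x * y = g}`. -/
theorem isLUB_mulFun (a b : FinPartition A G) (g : G) :
    IsLUB {z | ∃ x y, x * y = g ∧ z = a x ⊓ b y} (mulFun a b g) := by
  constructor
  · rintro _ ⟨x, y, rfl, rfl⟩
    exact le_mulFun a b x y
  · exact fun z hz => mulFun_le fun x y hxy => hz ⟨x, y, hxy, rfl⟩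

noncomputable instance : Mul (FinPartition A G) where
  mul a b :=
    { toFun := mulFun a b
      finite_support := by
        refine (Set.Finite.image2 (· * ·) a.finite_support b.finite_support).subset ?_
        intro g hg
        by_contra hcon
        refine hg (le_bot_iff.1 (mulFun_le fun x y hxy => ?_))
        by_cases hx : a x = ⊥
        · simp [hx]
        by_cases hy : b y = ⊥
        · simp [hy]
        exact (hcon ⟨x, hx, y, hy, hxy⟩).elim
      isLUB_range := by
        refine ⟨fun _ _ => le_top, fun z hz => a.le_of_forall fun x => b.le_of_forall fun y => ?_⟩
        rw [top_inf_eq]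
        exact (le_mulFun a b x y).trans (hz ⟨_, rfl⟩)
      disjoint := by
        intro g g' hne
        refine le_bot_iff.1 ?_
        rw [← le_himp_iff]
        refine mulFun_le fun x y hxy => ?_
        rw [le_himp_iff, inf_comm, ← le_himp_iff]
        refine mulFun_le fun x' y' hxy' => ?_
        rw [le_himp_iff]
        by_cases hx : x' = x
        · have hy : y' ≠ y := by
            rintro rfl
            exact hne (by rw [← hxy, ← hxy', hx])
          rw [← b.disjoint y' y hy]
          exact inf_le_inf inf_le_right inf_le_right
        · rw [← a.disjoint x' x hx]
          exact inf_le_inf inf_le_left inf_le_left }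

theorem mul_apply (a b : FinPartition A G) (g : G) : (a * b) g = mulFun a b g := rfl

theorem inf_le_mul (a b : FinPartition A G) (x y : G) : a x ⊓ b y ≤ (a * b) (x * y) :=
  le_mulFun a b x y

theorem mul_le {a b : FinPartition A G} {g : G} {z : A}
    (h : ∀ x y, x * y = g → a x ⊓ b y ≤ z) : (a * b) g ≤ z :=
  mulFun_le h

noncomputable instance : One (FinPartition A G) where
  one :=
    { toFun := fun g => open Classical in if g = 1 then ⊤ else ⊥
      finite_support := by
        refine (Set.finite_singleton (1 : G)).subset fun g hg => ?_
        by_contra hcon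
        exact hg (if_neg hcon)
      isLUB_range := by
        refine ⟨fun _ _ => le_top, fun z hz => hz ⟨1, if_pos rfl⟩⟩
      disjoint := by
        intro g h hne
        by_cases hg : g = 1
        · have hh : h ≠ 1 := fun hh => hne (hg.trans hh.symm)
          simp [hh]
        · simp [hg] }

theorem one_apply_one : (1 : FinPartition A G) 1 = ⊤ := if_pos rfl

theorem one_apply_ne {g : G} (hg : g ≠ 1) : (1 : FinPartition A G) g = ⊥ := if_neg hg

instance : Inv (FinPartition A G) where
  inv a :=
    { toFun := fun g => a g⁻¹
      finite_support := by
        refine (a.finite_support.image (fun g => g⁻¹)).subset fun g hg => ⟨g⁻¹, hg, by simp⟩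
      isLUB_range := by
        refine ⟨fun _ _ => le_top, fun z hz => a.isLUB_range.2 ?_⟩
        rintro _ ⟨g, rfl⟩
        exact hz ⟨g⁻¹, by simp⟩
      disjoint := fun g h hne => a.disjoint _ _ (fun h' => hne (inv_injective h')) }

theorem inv_apply (a : FinPartition A G) (g : G) : a⁻¹ g = a g⁻¹ := rfl

noncomputable instance : Group (FinPartition A G) where
  mul_assoc a b c := by
    refine eq_of_le fun g => mul_le fun w z hwz => ?_
    rw [← le_himp_iff]
    refine mul_le fun x y hxy => ?_
    rw [le_himp_iff, inf_assoc]
    subst hwz hxy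
    rw [mul_assoc]
    exact (inf_le_inf_left _ (inf_le_mul b c y z)).trans (inf_le_mul a (b * c) x (y * z))
  one_mul a := by
    refine eq_of_le fun g => mul_le fun x y hxy => ?_
    by_cases hx : x = 1
    · subst hx hxy; simp
    · simp [one_apply_ne hx]
  mul_one a := by
    refine eq_of_le fun g => mul_le fun x y hxy => ?_
    by_cases hy : y = 1
    · subst hy hxy; simp
    · simp [one_apply_ne hy]
  inv_mul_cancel a := by
    refine eq_of_le fun g => mul_le fun x y hxy => ?_
    by_cases hg : g = 1
    · subst hg; rw [one_apply_one]; exact le_top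
    · rw [inv_apply, a.disjoint]
      · exact bot_le
      · rintro rfl
        exact hg (by rw [← hxy]; simp)

end FinPartition

/-! ### The topological group `S(φ, G)` -/

section S

variable {A : Type u} [BooleanAlgebra A] (φ : Submeasure A) {G : Type v}

/-- The basic sets `N_φ(U, ε)`: all `a` with `φ (a[G \ U]) ≤ ε`. -/
def basicNhd (U : Set G) (ε : ℝ) : Set (FinPartition A G) := {a | φ (a.on Uᶜ) ≤ ε}

theorem basicNhd_mono {U V : Set G} {ε δ : ℝ} (hUV : U ⊆ V) (h : ε ≤ δ) :
    basicNhd φ U ε ⊆ basicNhd φ V δ := fun a (ha : φ (a.on Uᶜ) ≤ ε) => by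
  refine le_trans (φ.monotone ?_) (ha.trans h)
  exact FinPartition.on_le _ fun g hg => FinPartition.le_on (A := A) a fun hg' => hg (hUV hg')

variable (G) [Group G] [TopologicalSpace G] [IsTopologicalGroup G]

/-- The sets `N_φ(U, ε)`, for `U` an identity neighborhood and `ε > 0`, form a group filter
basis. -/
@[reducible]
noncomputable def filterBasis : GroupFilterBasis (FinPartition A G) where
  sets := {N | ∃ U ∈ 𝓝 (1 : G), ∃ ε : ℝ, 0 < ε ∧ N = basicNhd φ U ε}
  nonempty := ⟨_, univ, univ_mem, 1, one_pos, rfl⟩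
  inter_sets := by
    rintro _ _ ⟨U, hU, ε, hε, rfl⟩ ⟨V, hV, δ, hδ, rfl⟩
    exact ⟨_, ⟨U ∩ V, inter_mem hU hV, min ε δ, lt_min hε hδ, rfl⟩,
      subset_inter (basicNhd_mono φ inter_subset_left (min_le_left _ _))
        (basicNhd_mono φ inter_subset_right (min_le_right _ _))⟩
  one' := by
    rintro _ ⟨U, hU, ε, hε, rfl⟩
    have h : (1 : FinPartition A G).on Uᶜ = ⊥ := le_bot_iff.1 <| FinPartition.on_le _ fun g hg =>
      (FinPartition.one_apply_ne (A := A) (g := g) (by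
        rintro rfl; exact hg (mem_of_mem_nhds hU))).le
    change φ ((1 : FinPartition A G).on Uᶜ) ≤ ε
    rw [h, φ.map_bot]
    exact hε.le
  mul' := by
    rintro _ ⟨U, hU, ε, hε, rfl⟩
    obtain ⟨V, hV, hVU⟩ := exists_nhds_one_split hU
    refine ⟨_, ⟨V, hV, ε / 2, half_pos hε, rfl⟩, ?_⟩
    rintro _ ⟨a, ha, b, hb, rfl⟩
    have ha : φ (a.on Vᶜ) ≤ ε / 2 := ha
    have hb : φ (b.on Vᶜ) ≤ ε / 2 := hb
    have key : (a * b).on Uᶜ ≤ a.on Vᶜ ⊔ b.on Vᶜ := by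
      refine FinPartition.on_le _ fun g hg => FinPartition.mul_le (A := A) fun x y hxy => ?_
      by_cases hx : x ∈ V
      · have hy : y ∉ V := fun hy => hg (hxy ▸ hVU x hx y hy)
        exact inf_le_right.trans ((FinPartition.le_on (A := A) b hy).trans le_sup_right)
      · exact inf_le_left.trans ((FinPartition.le_on (A := A) a hx).trans le_sup_left)
    change φ ((a * b).on Uᶜ) ≤ ε
    have h1 := φ.monotone key
    have h2 := φ.subadditive (a.on Vᶜ) (b.on Vᶜ)
    linarith
  inv' := by
    rintro _ ⟨U, hU, ε, hε, rfl⟩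
    refine ⟨_, ⟨U⁻¹, inv_mem_nhds_one G hU, ε, hε, rfl⟩, fun a ha => ?_⟩
    refine le_trans (φ.monotone ?_) ha
    refine FinPartition.on_le _ fun g hg => ?_
    refine FinPartition.le_on (A := A) a (g := g⁻¹) ?_
    simpa using hg
  conj' := by
    rintro x _ ⟨U, hU, ε, hε, rfl⟩
    let s : Finset G := FinPartition.support (A := A) x
    have hV : (⋂ h ∈ s, {v : G | h * v * h⁻¹ ∈ U}) ∈ 𝓝 (1 : G) := by
      refine (Filter.biInter_finset_mem s).2 fun h _ => ?_
      have hc : Tendsto (fun v : G => h * v * h⁻¹) (𝓝 1) (𝓝 (h * 1 * h⁻¹)) :=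
        Continuous.tendsto (by fun_prop) 1
      rw [mul_one, mul_inv_cancel] at hc
      exact hc hU
    refine ⟨_, ⟨_, hV, ε, hε, rfl⟩, fun a ha => ?_⟩
    refine le_trans (φ.monotone ?_) ha
    refine FinPartition.on_le _ fun g hg => FinPartition.mul_le (A := A) fun k l hkl => ?_
    rw [← le_himp_iff]
    refine FinPartition.mul_le (A := A) fun h y hhy => ?_
    rw [le_himp_iff, FinPartition.inv_apply]
    by_cases hl : h = l⁻¹
    · by_cases hb : (x : FinPartition A G) h = ⊥
      · rw [hb]; simp
      refine (inf_le_left.trans inf_le_right).trans (FinPartition.le_on (A := A) a ?_)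
      intro hy
      have := Set.mem_iInter₂.1 hy h (FinPartition.mem_support.2 hb)
      refine hg ?_
      have e : h * y * h⁻¹ = g := by rw [hhy, hl, inv_inv, hkl]
      exact e ▸ this
    · refine (inf_le_inf_right _ inf_le_left).trans ?_
      rw [FinPartition.disjoint (A := A) x _ _ hl]
      exact bot_le

/-- The group of finite `G`-partitions of unity, endowed with the `φ`-topology. -/
def S {A : Type u} [BooleanAlgebra A] (_φ : Submeasure A) (G : Type v) : Type (max u v) :=
  FinPartition A G

noncomputable instance : Group (S φ G) := inferInstanceAs (Group (FinPartition A G))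

/-- The `φ`-topology on `S(φ, G)`. -/
noncomputable instance : TopologicalSpace (S φ G) := (filterBasis φ G).topology

instance : IsTopologicalGroup (S φ G) := (filterBasis φ G).isTopologicalGroup

/-- The sets `N_φ(U, ε)` form a neighborhood basis at the identity. -/
theorem nhds_one_hasBasis : (𝓝 (1 : S φ G)).HasBasis
    (fun p : Set G × ℝ => p.1 ∈ 𝓝 (1 : G) ∧ 0 < p.2) (fun p => (basicNhd φ p.1 p.2 : Set (FinPartition A G))) := by
  refine ⟨fun t => ?_⟩
  refine ((filterBasis φ G).nhds_one_hasBasis.mem_iff (t := t)).trans ?_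
  constructor
  · rintro ⟨_, ⟨U, hU, ε, hε, rfl⟩, h⟩
    exact ⟨(U, ε), ⟨hU, hε⟩, h⟩
  · rintro ⟨p, ⟨hU, hε⟩, h⟩
    exact ⟨_, ⟨p.1, hU, p.2, hε, rfl⟩, h⟩

end S

/-! ### The Raikov completion of a topological group -/

section Raikov

/-- The bilateral uniformity of a topological group: the coarsest uniformity finer than the left
and the right uniformity. -/
@[reducible]
def bilateralUniformSpace (X : Type u) [Group X] [TopologicalSpace X] [IsTopologicalGroup X] :
    UniformSpace X :=
  (IsTopologicalGroup.leftUniformSpace X ⊓ IsTopologicalGroup.rightUniformSpace X).replaceTopology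
    (by rw [UniformSpace.toTopologicalSpace_inf]; exact (inf_idem _).symm)

variable {X : Type u} [Group X] [TopologicalSpace X] [IsTopologicalGroup X]

theorem bilateral_uniformity :
    @uniformity X (bilateralUniformSpace X) =
      comap (fun p : X × X => p.1⁻¹ * p.2) (𝓝 1) ⊓ comap (fun p : X × X => p.2 * p.1⁻¹) (𝓝 1) :=
  rfl

/-- The bilateral uniformity consists of all `E` for which there is an identity neighborhood `U`
such that `x ∈ y U ∩ U y` implies `(x, y) ∈ E`. -/
theorem mem_bilateral_uniformity {E : Set (X × X)} :
    E ∈ @uniformity X (bilateralUniformSpace X) ↔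
      ∃ U ∈ 𝓝 (1 : X), ∀ x y : X, y⁻¹ * x ∈ U → x * y⁻¹ ∈ U → (x, y) ∈ E := by
  let _ := bilateralUniformSpace X
  rw [show uniformity X = comap Prod.swap (uniformity X) from
    uniformity_eq_symm.trans map_swap_eq_comap_swap, bilateral_uniformity, comap_inf, comap_comap,
    comap_comap]
  constructor
  · rintro ⟨E₁, ⟨U, hU, h₁⟩, E₂, ⟨V, hV, h₂⟩, rfl⟩
    exact ⟨U ∩ V, inter_mem hU hV, fun x y hx hy => ⟨h₁ hx.1, h₂ hy.2⟩⟩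
  · rintro ⟨U, hU, h⟩
    exact mem_of_superset (inter_mem_inf (preimage_mem_comap hU) (preimage_mem_comap hU))
      fun p hp => h p.1 p.2 hp.1 hp.2

theorem cauchy_bilateral_iff {F : Filter X} :
    @Cauchy X (bilateralUniformSpace X) F ↔
      F.NeBot ∧ ∀ U ∈ 𝓝 (1 : X), ∃ s ∈ F, ∀ x ∈ s, ∀ y ∈ s, y⁻¹ * x ∈ U ∧ x * y⁻¹ ∈ U := by
  let _ := bilateralUniformSpace X
  rw [cauchy_iff]
  refine and_congr_right fun _ => ⟨fun h U hU => ?_, fun h E hE => ?_⟩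
  · obtain ⟨s, hs, hsE⟩ := h {p | p.2⁻¹ * p.1 ∈ U ∧ p.1 * p.2⁻¹ ∈ U}
      (mem_bilateral_uniformity.2 ⟨U, hU, fun x y h₁ h₂ => ⟨h₁, h₂⟩⟩)
    exact ⟨s, hs, fun x hx y hy => hsE (mk_mem_prod hx hy)⟩
  · obtain ⟨U, hU, hUE⟩ := mem_bilateral_uniformity.1 hE
    obtain ⟨s, hs, h⟩ := h U hU
    exact ⟨s, hs, fun p hp => hUE _ _ (h _ hp.1 _ hp.2).1 (h _ hp.1 _ hp.2).2⟩

/-- Products of bilaterally Cauchy filters are bilaterally Cauchy. -/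
theorem cauchy_mul {F F' : Filter X} (hF : @Cauchy X (bilateralUniformSpace X) F)
    (hF' : @Cauchy X (bilateralUniformSpace X) F') :
    @Cauchy X (bilateralUniformSpace X) (map (fun p : X × X => p.1 * p.2) (F ×ˢ F')) := by
  rw [cauchy_bilateral_iff] at *
  obtain ⟨hne, hF⟩ := hF
  obtain ⟨hne', hF'⟩ := hF'
  refine ⟨inferInstance, fun U hU => ?_⟩
  have hT : Tendsto (fun p : X × X × X => p.1 * p.2.1 * p.2.2) (𝓝 1 ×ˢ 𝓝 1 ×ˢ 𝓝 1) (𝓝 1) := by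
    have h : Continuous (fun p : X × X × X => p.1 * p.2.1 * p.2.2) := by fun_prop
    have := h.tendsto (1, 1, 1)
    simpa [nhds_prod_eq] using this
  obtain ⟨V₁, hV₁, W, hW, h₁⟩ := mem_prod_iff.1 (hT hU)
  obtain ⟨V₂, hV₂, V₃, hV₃, h₂⟩ := mem_prod_iff.1 hW
  let V := V₁ ∩ (V₂ ∩ V₃)
  have hV : V ∈ 𝓝 (1 : X) := inter_mem hV₁ (inter_mem hV₂ hV₃)
  have hmul : ∀ x ∈ V, ∀ y ∈ V, ∀ z ∈ V, x * y * z ∈ U := fun x hx y hy z hz =>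
    h₁ (show ((x, y, z) : X × X × X) ∈ V₁ ×ˢ W from
      ⟨hx.1, h₂ (show ((y, z) : X × X) ∈ V₂ ×ˢ V₃ from ⟨hy.2.1, hz.2.2⟩)⟩)
  have hconj : ∀ c : X, {v : X | c * v * c⁻¹ ∈ V} ∈ 𝓝 (1 : X) := fun c => by
    have hc : Tendsto (fun v : X => c * v * c⁻¹) (𝓝 1) (𝓝 (c * 1 * c⁻¹)) :=
      Continuous.tendsto (by fun_prop) 1
    rw [mul_one, mul_inv_cancel] at hc
    exact hc hV
  obtain ⟨s, hs, hsV⟩ := hF V hV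
  obtain ⟨t, ht, htV⟩ := hF' V hV
  obtain ⟨a, ha⟩ := hne.nonempty_of_mem hs
  obtain ⟨b, hb⟩ := hne'.nonempty_of_mem ht
  obtain ⟨s', hs', hsV'⟩ := hF _ (hconj b⁻¹)
  obtain ⟨t', ht', htV'⟩ := hF' _ (hconj a)
  refine ⟨_, image_mem_map (prod_mem_prod (inter_mem hs hs') (inter_mem ht ht')), ?_⟩
  rintro _ ⟨⟨x, y⟩, ⟨hx, hy⟩, rfl⟩ _ ⟨⟨x', y'⟩, ⟨hx', hy'⟩, rfl⟩
  constructor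
  · have := hmul _ (htV b hb y' hy'.1).1 _ (hsV' x hx.2 x' hx'.2).1 _ (htV y hy.1 b hb).1
    convert this using 1
    simp only [inv_inv]
    group
  · have := hmul _ (hsV x hx.1 a ha).2 _ (htV' y hy.2 y' hy'.2).2 _ (hsV a ha x' hx'.1).2
    convert this using 1
    group

theorem uniformContinuous_inv_bilateral :
    @UniformContinuous X X (bilateralUniformSpace X) (bilateralUniformSpace X) (fun x => x⁻¹) := by
  let _ := bilateralUniformSpace X
  intro E hE
  obtain ⟨U, hU, h⟩ := mem_bilateral_uniformity.1 hE
  refine mem_bilateral_uniformity.2 ⟨U⁻¹, inv_mem_nhds_one X hU, fun x y h₁ h₂ => h _ _ ?_ ?_⟩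
  · simpa using h₂
  · simpa using h₁

variable (X) in
/-- The Raikov completion: the Hausdorff completion with respect to the bilateral uniformity. -/
def RaikovCompletion : Type u :=
  @UniformSpace.Completion X (bilateralUniformSpace X)

namespace RaikovCompletion

instance : UniformSpace (RaikovCompletion X) :=
  @UniformSpace.Completion.uniformSpace X (bilateralUniformSpace X)

instance : CompleteSpace (RaikovCompletion X) :=
  @UniformSpace.Completion.completeSpace X (bilateralUniformSpace X)

instance : T0Space (RaikovCompletion X) :=
  @UniformSpace.Completion.t0Space X (bilateralUniformSpace X)

/-- The canonical map of a topological group to its Raikov completion. -/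
def ι (x : X) : RaikovCompletion X :=
  @UniformSpace.Completion.coe' X (bilateralUniformSpace X) x

theorem isUniformInducing_ι :
    @IsUniformInducing X (RaikovCompletion X) (bilateralUniformSpace X) _ ι :=
  @UniformSpace.Completion.isUniformInducing_coe X (bilateralUniformSpace X)

theorem isDenseInducing_ι : IsDenseInducing (ι : X → RaikovCompletion X) :=
  @UniformSpace.Completion.isDenseInducing_coe X (bilateralUniformSpace X)

theorem continuous_ι : Continuous (ι : X → RaikovCompletion X) :=
  isDenseInducing_ι.continuous

theorem isDenseInducing_ι₂ :
    IsDenseInducing (Prod.map ι ι : X × X → RaikovCompletion X × RaikovCompletion X) :=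
  isDenseInducing_ι.prodMap isDenseInducing_ι

/-- The multiplication of the completion is the continuous extension of that of the group. -/
noncomputable instance : Mul (RaikovCompletion X) where
  mul p q := isDenseInducing_ι₂.extend (fun z : X × X => ι (z.1 * z.2)) (p, q)

/-- The inversion of the completion is the continuous extension of that of the group. -/
noncomputable instance : Inv (RaikovCompletion X) where
  inv p := isDenseInducing_ι.extend (fun x : X => ι x⁻¹) p

instance : One (RaikovCompletion X) where
  one := ι 1

theorem continuous_mul' : Continuous fun p : RaikovCompletion X × RaikovCompletion X =>
    p.1 * p.2 := by
  refine isDenseInducing_ι₂.continuous_extend (f := fun z : X × X => (ι (z.1 * z.2) :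
    RaikovCompletion X)) fun p => ?_
  let _ := bilateralUniformSpace X
  have hc : ∀ p : RaikovCompletion X, Cauchy (comap ι (𝓝 p)) := fun p => by
    have := isDenseInducing_ι.comap_nhds_neBot p
    exact cauchy_nhds.comap' isUniformInducing_ι.comap_uniformity.le inferInstance
  have h := (cauchy_mul (hc p.1) (hc p.2)).map isUniformInducing_ι.uniformContinuous
  obtain ⟨c, h⟩ := CompleteSpace.complete h
  refine ⟨c, ?_⟩
  rw [nhds_prod_eq]
  change map _ (comap (fun q : X × X => (ι q.1, ι q.2)) (𝓝 p.1 ×ˢ 𝓝 p.2)) ≤ 𝓝 c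
  rw [← prod_comap_comap_eq]
  exact h

theorem continuous_inv' : Continuous fun p : RaikovCompletion X => p⁻¹ := by
  refine isDenseInducing_ι.continuous_extend (f := fun x : X => (ι x⁻¹ :
    RaikovCompletion X)) fun p => ?_
  let _ := bilateralUniformSpace X
  have := isDenseInducing_ι.comap_nhds_neBot p
  have hc : Cauchy (comap (ι : X → RaikovCompletion X) (𝓝 p)) :=
    cauchy_nhds.comap' isUniformInducing_ι.comap_uniformity.le inferInstance
  have h := hc.map (isUniformInducing_ι.uniformContinuous.comp uniformContinuous_inv_bilateral)
  exact CompleteSpace.complete h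

theorem ι_one : ι (1 : X) = 1 := rfl

theorem ι_mul (x y : X) : ι (x * y) = (ι x * ι y : RaikovCompletion X) :=
  (isDenseInducing_ι₂.extend_eq (f := fun z : X × X => (ι (z.1 * z.2) : RaikovCompletion X))
    (continuous_ι.comp continuous_mul) (x, y)).symm

theorem ι_inv (x : X) : ι x⁻¹ = (ι x : RaikovCompletion X)⁻¹ :=
  (isDenseInducing_ι.extend_eq (f := fun x : X => (ι x⁻¹ : RaikovCompletion X))
    (continuous_ι.comp continuous_inv) x).symm

instance : ContinuousMul (RaikovCompletion X) := ⟨continuous_mul'⟩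

instance : ContinuousInv (RaikovCompletion X) := ⟨continuous_inv'⟩

noncomputable instance : Group (RaikovCompletion X) where
  mul_assoc p q r :=
    isClosed_property3 (p := fun p q r : RaikovCompletion X => p * q * r = p * (q * r))
      (isDenseInducing_ι (X := X)).dense
      (isClosed_eq (by fun_prop) (by fun_prop) :
        IsClosed {z : RaikovCompletion X × RaikovCompletion X × RaikovCompletion X |
          z.1 * z.2.1 * z.2.2 = z.1 * (z.2.1 * z.2.2)})
      (fun x y z => by simp only [← ι_mul, mul_assoc]) p q r
  one_mul p :=
    isClosed_property (isDenseInducing_ι (X := X)).dense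
      (isClosed_eq (by fun_prop) (by fun_prop) : IsClosed {z : RaikovCompletion X | 1 * z = z})
      (fun x => by rw [← ι_one, ← ι_mul, one_mul]) p
  mul_one p :=
    isClosed_property (isDenseInducing_ι (X := X)).dense
      (isClosed_eq (by fun_prop) (by fun_prop) : IsClosed {z : RaikovCompletion X | z * 1 = z})
      (fun x => by rw [← ι_one, ← ι_mul, mul_one]) p
  inv_mul_cancel p :=
    isClosed_property (isDenseInducing_ι (X := X)).dense
      (isClosed_eq (by fun_prop) (by fun_prop) : IsClosed {z : RaikovCompletion X | z⁻¹ * z = 1})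
      (fun x => by rw [← ι_inv, ← ι_mul, inv_mul_cancel, ι_one]) p

instance : IsTopologicalGroup (RaikovCompletion X) where
  continuous_mul := continuous_mul'
  continuous_inv := continuous_inv'

end RaikovCompletion

end Raikov

/-- The topological group `L⁰(φ, G)`: the Raikov completion of `S(φ, G)`. -/
abbrev L0 {A : Type u} [BooleanAlgebra A] (φ : Submeasure A) (G : Type v) [Group G]
    [TopologicalSpace G] [IsTopologicalGroup G] : Type (max u v) :=
  RaikovCompletion (S φ G)

end LZero

/-! By density it suffices to treat a partition `a` in `S(φ, G)`. Let `P` be a finite partition of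
unity refining `a`, with labels `k j`. Then `m ↦ (k j ^ m j)` is a homomorphism from `ℤ ^ P` to
`S(φ, G)` taking the constant vector 1 to `a`. If the union of a set `I` of parts is `φ`-small, this
homomorphism sends all of `ℤ ^ I` into a prescribed identity neighborhood, so its composite with `π`
is uniformly `μ`-small on `ℤ ^ I`.

The escape property converts this into a bound free of `|I|` (`measure_sup_le`). Where the image of
a basis vector `e j` is not `f`-small, one of its first `n` powers leaves `U`. Hence a quarter of
the vectors in a large box of `ℤ ^ I` have image outside `V` at that point. Averaging over the box
bounds the union, over `j ∈ I`, of the bad sets of the `e j` by a fixed multiple of `ε`.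

Pathologicality passes from `φ`-small `I` to all of `P` (`measure_sup_le_of_witness`).
Disjointifying the bad sets gives weights on the parts. Outside a suitable `φ`-small `I` these are
dominated by a multiple of `φ`, and on a fine enough `P` they are additive on a finite set of pairs
that already forces small total mass (`Submeasure.IsPathological.exists_finset`). So off a small set
every `e j` has `f`-small image, and so does their sum, which represents `a`.

As `π` takes values in a completion, all this is carried out for maps `σ` from `ℤ ^ P` to `S(μ, H)`
that approximate the homomorphism. -/

namespace LZero

/-! ### Points of Boolean algebras -/

section Points

variable {A : Type*} [BooleanAlgebra A]

/-- Every non-zero element of a Boolean algebra belongs to some point of the Stone space. -/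
theorem exists_point {x : A} (hx : x ≠ ⊥) : ∃ ω : BoundedLatticeHom A Prop, ω x := by
  -- The point is the complement of a prime ideal that avoids the filter above `x`.
  obtain ⟨I, hI, -, hd⟩ := DistribLattice.prime_ideal_of_disjoint_filter_ideal
    (F := Order.PFilter.principal x) (I := (⊥ : Order.Ideal A)) (by
      rw [Set.disjoint_left]
      intro y hy hy'
      have h1 : x ≤ y := hy
      have h2 : y = ⊥ := le_bot_iff.1 hy'
      exact hx (le_bot_iff.1 (h2 ▸ h1)))
  refine ⟨⟨⟨⟨fun y => y ∉ I, fun y z => ?_⟩, fun y z => ?_⟩, ?_, ?_⟩, ?_⟩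
  · simp only [Order.Ideal.sup_mem_iff, sup_Prop_eq]
    exact propext not_and_or
  · change (y ⊓ z ∉ I) = (y ∉ I ∧ z ∉ I)
    refine propext ⟨fun h => ⟨fun hy => h (I.lower inf_le_left hy),
      fun hz => h (I.lower inf_le_right hz)⟩, fun h hyz => ?_⟩
    exact (hI.mem_or_mem hyz).elim h.1 h.2
  · exact eq_true (hI.toIsProper.top_notMem)
  · exact eq_false (fun h => h I.bot_mem)
  · exact Set.disjoint_left.1 hd (le_refl x : x ≤ x)

variable (ω : BoundedLatticeHom A Prop)

theorem point_sup {x y : A} : ω (x ⊔ y) ↔ ω x ∨ ω y := by simp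

theorem point_inf {x y : A} : ω (x ⊓ y) ↔ ω x ∧ ω y := by simp

theorem point_top : ω ⊤ := by simp

theorem point_bot : ¬ ω ⊥ := by simp

theorem point_sdiff {x y : A} : ω (x \ y) ↔ ω x ∧ ¬ ω y := by rw [map_sdiff']; rfl

theorem point_mono {x y : A} (h : x ≤ y) (hx : ω x) : ω y :=
  (OrderHomClass.mono ω h : ω x ≤ ω y) hx

theorem point_finset_sup {κ : Type*} (s : Finset κ) (f : κ → A) :
    ω (s.sup f) ↔ ∃ i ∈ s, ω (f i) := by
  classical
  induction s using Finset.induction_on with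
  | empty => simp
  | insert i s _ ih => simp [ih]

variable {ω}

/-- A point of `x \ y` would separate `x` from `y`. Inclusions can thus be checked pointwise, as for
sets. -/
theorem le_of_points {x y : A} (h : ∀ ω : BoundedLatticeHom A Prop, ω x → ω y) : x ≤ y := by
  by_contra hxy
  obtain ⟨ω, hω⟩ := exists_point (x := x \ y) (fun h0 => hxy (sdiff_eq_bot_iff.1 h0))
  exact ((point_sdiff ω).1 hω).2 (h ω ((point_sdiff ω).1 hω).1)

variable {L : Type*}

theorem FinPartition.exists_label (ω : BoundedLatticeHom A Prop) (a : FinPartition A L) :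
    ∃ l, ω (a l) := by
  classical
  have h := point_top ω
  rw [← a.on_univ, FinPartition.on, point_finset_sup] at h
  exact ⟨h.choose, h.choose_spec.2⟩

/-- The label of the part of `a` that contains the point `ω`. -/
noncomputable def FinPartition.label (ω : BoundedLatticeHom A Prop) (a : FinPartition A L) : L :=
  (a.exists_label ω).choose

theorem FinPartition.point_apply_iff {a : FinPartition A L} {l : L} :
    ω (a l) ↔ a.label ω = l := by
  have h : ω (a (a.label ω)) := (a.exists_label ω).choose_spec
  refine ⟨fun hl => ?_, fun hl => hl ▸ h⟩
  by_contra hne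
  have := (point_inf ω).2 ⟨h, hl⟩
  rw [a.disjoint _ _ hne] at this
  exact point_bot ω this

theorem FinPartition.point_on_iff {a : FinPartition A L} {T : Set L} :
    ω (a.on T) ↔ a.label ω ∈ T := by
  classical
  constructor
  · intro h
    rw [FinPartition.on, point_finset_sup] at h
    obtain ⟨l, hl, hωl⟩ := h
    rw [point_apply_iff.1 hωl]
    exact (Finset.mem_filter.1 hl).2
  · intro h
    exact point_mono ω (a.le_on h) (point_apply_iff.2 rfl)

theorem FinPartition.ext_label {a b : FinPartition A L}
    (h : ∀ ω : BoundedLatticeHom A Prop, a.label ω = b.label ω) : a = b :=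
  eq_of_le fun l => le_of_points fun ω hω => by
    rw [point_apply_iff] at hω ⊢
    rw [← h, hω]

variable [Group L]

theorem FinPartition.label_one : (1 : FinPartition A L).label ω = 1 :=
  point_apply_iff.1 (by rw [one_apply_one]; exact point_top ω)

/-- Partitions behave as step functions on the Stone space with pointwise multiplication. -/
theorem FinPartition.label_mul (a b : FinPartition A L) :
    (a * b).label ω = a.label ω * b.label ω :=
  point_apply_iff.1 (point_mono ω (inf_le_mul a b _ _)
    ((point_inf ω).2 ⟨point_apply_iff.2 rfl, point_apply_iff.2 rfl⟩))

/-- The evaluation of `S(φ, L)` at a point of the Stone space. -/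
noncomputable def evalHom (φ : Submeasure A) [TopologicalSpace L] [IsTopologicalGroup L]
    (ω : BoundedLatticeHom A Prop) : S φ L →* L where
  toFun a := FinPartition.label ω a
  map_one' := FinPartition.label_one
  map_mul' := FinPartition.label_mul

end Points

/-! ### Finite partitions of unity that decide finitely many elements -/

section Parts

variable {A : Type*} [BooleanAlgebra A]

/-- Take common refinements with the two-part partitions `{x, xᶜ}`, for `x ∈ F`. -/
theorem exists_finpartition_decides (F : Finset A) :
    ∃ P : Finpartition (⊤ : A), ∀ x ∈ F, ∀ j ∈ P.parts, j ≤ x ∨ Disjoint j x := by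
  classical
  induction F using Finset.induction_on with
  | empty => exact ⟨Classical.arbitrary _, by simp⟩
  | insert x F _ ih =>
    obtain ⟨P, hP⟩ := ih
    -- `⊥` is erased because `x` may be `⊥` or `⊤`.
    let Q : Finpartition (⊤ : A) := Finpartition.ofErase {x, xᶜ}
      (by
        refine Set.PairwiseDisjoint.supIndep ?_
        rw [Finset.coe_pair]
        refine (Set.pairwiseDisjoint_insert).2 ⟨Set.pairwiseDisjoint_singleton _ _, ?_⟩
        rintro _ rfl -
        exact disjoint_compl_right) (by simp)
    have hQ : ∀ j ∈ Q.parts, j ≤ x ∨ Disjoint j x := by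
      intro j hj
      have : j ∈ ({x, xᶜ} : Finset A) := Finset.mem_of_mem_erase hj
      rcases Finset.mem_insert.1 this with rfl | h
      · exact Or.inl le_rfl
      · rw [Finset.mem_singleton] at h
        subst h
        exact Or.inr disjoint_compl_left
    refine ⟨P ⊓ Q, fun y hy j hj => ?_⟩
    rcases Finset.mem_insert.1 hy with rfl | hy
    · obtain ⟨q, hq, hjq⟩ := (inf_le_right : P ⊓ Q ≤ Q) hj
      exact (hQ q hq).imp hjq.trans fun h => h.mono_left hjq
    · obtain ⟨q, hq, hjq⟩ := (inf_le_left : P ⊓ Q ≤ P) hj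
      exact (hP y hy q hq).imp hjq.trans fun h => h.mono_left hjq

variable {P : Finpartition (⊤ : A)} {ω : BoundedLatticeHom A Prop}

theorem exists_part (P : Finpartition (⊤ : A)) (ω : BoundedLatticeHom A Prop) :
    ∃ j : P.parts, ω j := by
  have h := point_top ω
  rw [← P.sup_parts, point_finset_sup] at h
  exact ⟨⟨h.choose, h.choose_spec.1⟩, h.choose_spec.2⟩

/-- The part of `P` that contains the point `ω`. -/
noncomputable def partAt (P : Finpartition (⊤ : A)) (ω : BoundedLatticeHom A Prop) : P.parts :=
  (exists_part P ω).choose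

theorem point_part_iff {j : P.parts} : ω (j : A) ↔ partAt P ω = j := by
  have h : ω (partAt P ω : A) := (exists_part P ω).choose_spec
  refine ⟨fun hj => ?_, fun hj => hj ▸ h⟩
  by_contra hne
  have := (point_inf ω).2 ⟨h, hj⟩
  have hd : Disjoint (partAt P ω : A) (j : A) :=
    P.disjoint (partAt P ω).2 j.2 (fun h => hne (Subtype.ext h))
  rw [hd.eq_bot] at this
  exact point_bot ω this

/-- The partition of unity with the label `k j` on the part `j` of `P`. -/
noncomputable def ofParts {G : Type*} (P : Finpartition (⊤ : A)) (k : P.parts → G) :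
    FinPartition A G where
  toFun g := open Classical in (Finset.univ.filter fun j => k j = g).sup fun j : P.parts => (j : A)
  finite_support := by
    classical
    refine (Set.finite_range k).subset fun g hg => ?_
    by_contra hcon
    refine hg ?_
    rw [Finset.filter_false_of_mem fun j _ h => hcon ⟨j, h⟩, Finset.sup_empty]
  isLUB_range := by
    classical
    refine ⟨fun _ _ => le_top, fun z hz => le_of_points fun ω _ => ?_⟩
    refine point_mono ω (hz ⟨k (partAt P ω), rfl⟩) ?_
    rw [point_finset_sup]
    exact ⟨partAt P ω, by simp, point_part_iff.2 rfl⟩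
  disjoint := by
    classical
    refine fun g h hne => le_bot_iff.1 (le_of_points fun ω hω => ?_)
    rw [point_inf, point_finset_sup, point_finset_sup] at hω
    obtain ⟨⟨i, hi, hωi⟩, ⟨j, hj, hωj⟩⟩ := hω
    rw [point_part_iff] at hωi hωj
    refine (hne ?_).elim
    rw [← (Finset.mem_filter.1 hi).2, ← (Finset.mem_filter.1 hj).2, ← hωi, ← hωj]

theorem label_ofParts {G : Type*} (k : P.parts → G) :
    (ofParts P k).label ω = k (partAt P ω) := by
  classical
  rw [← FinPartition.point_apply_iff]
  change ω (Finset.sup _ _)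
  rw [point_finset_sup]
  exact ⟨partAt P ω, by simp, point_part_iff.2 rfl⟩

theorem ofParts_mul {G : Type*} [Group G] (k l : P.parts → G) :
    ofParts P (k * l) = ofParts P k * ofParts P l :=
  FinPartition.ext_label fun ω => by simp [FinPartition.label_mul, label_ofParts]

/-- If every part of `P` lies in a part of `a`, then `a` is determined by its labels on `P`. -/
theorem exists_ofParts_eq {G : Type*} (a : FinPartition A G)
    (h : ∀ g, ∀ j ∈ P.parts, j ≤ a g ∨ Disjoint j (a g)) : ∃ k : P.parts → G, ofParts P k = a := by
  have h' : ∀ j : P.parts, ∃ g, (j : A) ≤ a g := by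
    intro j
    -- The non-zero part `j` contains a point. It meets the part of `a` at that point, hence lies
    -- inside it.
    obtain ⟨ω, hω⟩ := exists_point (P.ne_bot j.2)
    refine ⟨a.label ω, (h _ j j.2).resolve_right fun hd => ?_⟩
    have := (point_inf ω).2 ⟨hω, (FinPartition.point_apply_iff (a := a)).2 rfl⟩
    rw [hd.eq_bot] at this
    exact point_bot ω this
  choose k hk using h'
  refine ⟨k, FinPartition.ext_label fun ω => ?_⟩
  rw [label_ofParts, eq_comm, ← FinPartition.point_apply_iff]
  exact point_mono ω (hk _) (point_part_iff.2 rfl)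

end Parts

/-! ### Counting and averaging with measures -/

section Measure

variable {B : Type*} [BooleanAlgebra B] {μ : B → ℝ}

theorem IsMeasure.nonneg (hμ : IsMeasure μ) (x : B) : 0 ≤ μ x := hμ.toSubmeasure.nonneg x

theorem IsMeasure.map_bot (hμ : IsMeasure μ) : μ ⊥ = 0 := hμ.toSubmeasure.map_bot

theorem IsMeasure.inf_add_sdiff (hμ : IsMeasure μ) (x y : B) : μ (x ⊓ y) + μ (x \ y) = μ x := by
  rw [← hμ.additive _ _ (by rw [← disjoint_iff]; exact disjoint_inf_sdiff), sup_inf_sdiff]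

theorem Submeasure.finset_sup_le (φ : Submeasure B) {κ : Type*} (s : Finset κ) (b : κ → B) :
    φ (s.sup b) ≤ ∑ i ∈ s, φ (b i) := by
  classical
  induction s using Finset.induction_on with
  | empty => simp [φ.map_bot]
  | insert i s hi ih =>
    rw [Finset.sup_insert, Finset.sum_insert hi]
    linarith [φ.subadditive (b i) (s.sup b)]

/-- If every point of `c` belongs to at least `m` of the sets `b i`, then `m * μ c` is at most the
sum of the measures of the sets `b i ⊓ c`. -/
theorem IsMeasure.mul_le_sum_inf (hμ : IsMeasure μ) {κ : Type*} (s : Finset κ) (b : κ → B) :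
    ∀ (c : B) (m : ℝ), (∀ ω : BoundedLatticeHom B Prop, ω c →
      ∃ t ⊆ s, (∀ i ∈ t, ω (b i)) ∧ m ≤ t.card) → m * μ c ≤ ∑ i ∈ s, μ (b i ⊓ c) := by
  classical
  induction s using Finset.induction_on with
  | empty =>
    intro c m h
    by_cases hc : c = ⊥
    · simp [hc, hμ.map_bot]
    · obtain ⟨ω, hω⟩ := exists_point hc
      obtain ⟨t, ht, -, hm⟩ := h ω hω
      rw [Finset.subset_empty.1 ht] at hm
      simpa using mul_nonpos_of_nonpos_of_nonneg (by simpa using hm) (hμ.nonneg c)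
  | insert i s hi ih =>
    intro c m h
    -- Split `c` along `b i`: inside `b i` this set uses up one of the `m` memberships, outside it
    -- uses none.
    have h1 := ih (c ⊓ b i) (m - 1) fun ω hω => by
      obtain ⟨t, ht, hb, hm⟩ := h ω ((point_inf ω).1 hω).1
      refine ⟨t.erase i, by rwa [← Finset.subset_insert_iff],
        fun j hj => hb j (Finset.mem_of_mem_erase hj), ?_⟩
      have : (t.card : ℝ) ≤ (t.erase i).card + 1 := by
        exact_mod_cast Nat.sub_le_iff_le_add.1 Finset.pred_card_le_card_erase
      linarith
    have h2 := ih (c \ b i) m fun ω hω => by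
      rw [point_sdiff] at hω
      obtain ⟨t, ht, hb, hm⟩ := h ω hω.1
      refine ⟨t, fun j hj => (Finset.mem_insert.1 (ht hj)).resolve_left ?_, hb, hm⟩
      rintro rfl
      exact hω.2 (hb j hj)
    have h3 : ∀ j, μ (b j ⊓ (c ⊓ b i)) + μ (b j ⊓ (c \ b i)) = μ (b j ⊓ c) := fun j => by
      rw [← inf_assoc, ← inf_sdiff_assoc, hμ.inf_add_sdiff]
    have h4 := hμ.inf_add_sdiff c (b i)
    rw [Finset.sum_insert hi, ← Finset.sum_congr rfl fun j _ => h3 j, Finset.sum_add_distrib,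
      inf_comm (b i) c, ← h4]
    linarith

/-- Given finitely many sets, there are weights, of the same total mass as the union of these sets,
such that the union of any subfamily has at least the mass given by the weights. -/
theorem IsMeasure.exists_weights (hμ : IsMeasure μ) {κ : Type*} (s : Finset κ) (d : κ → B) :
    ∃ w : κ → ℝ, (∀ i, 0 ≤ w i) ∧ (∀ t ⊆ s, ∑ i ∈ t, w i ≤ μ (t.sup d)) ∧
      ∑ i ∈ s, w i = μ (s.sup d) := by
  classical
  induction s using Finset.induction_on with
  | empty =>
    exact ⟨0, fun _ => le_rfl, fun t ht => by simp [Finset.subset_empty.1 ht, hμ.map_bot],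
      by simp [hμ.map_bot]⟩
  | insert i s hi ih =>
    obtain ⟨w, hw, hle, heq⟩ := ih
    -- The new weight is the mass of the portion of `d i` not yet covered.
    let v := Function.update w i (μ (d i \ s.sup d))
    have hv : ∀ t : Finset κ, i ∉ t → ∑ j ∈ t, v j = ∑ j ∈ t, w j := fun t ht =>
      Finset.sum_congr rfl fun j hj => Function.update_of_ne (by rintro rfl; exact ht hj) _ _
    have hvi : v i = μ (d i \ s.sup d) := Function.update_self ..
    refine ⟨v, fun j => ?_, fun t ht => ?_, ?_⟩
    · by_cases h : j = i
      · rw [h, hvi]; exact hμ.nonneg _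
      · rw [show v j = w j from Function.update_of_ne h _ _]; exact hw j
    · by_cases h : i ∈ t
      · have hts : t.erase i ⊆ s := by rwa [← Finset.subset_insert_iff]
        rw [← Finset.insert_erase h, Finset.sum_insert (Finset.notMem_erase i t),
          hv _ (Finset.notMem_erase i t), hvi, Finset.sup_insert]
        calc μ (d i \ s.sup d) + ∑ j ∈ t.erase i, w j
            ≤ μ (d i \ s.sup d) + μ ((t.erase i).sup d) := by linarith [hle _ hts]
          _ = μ (d i \ s.sup d ⊔ (t.erase i).sup d) := (hμ.additive _ _ (by
              rw [← disjoint_iff]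
              exact disjoint_sdiff_self_left.mono_right (Finset.sup_mono hts))).symm
          _ ≤ _ := hμ.monotone (sup_le_sup_right sdiff_le _)
      · rw [hv t h]
        exact hle t fun j hj => (Finset.mem_insert.1 (ht hj)).resolve_left fun h' => h (h' ▸ hj)
    · rw [Finset.sum_insert hi, hv s hi, hvi, heq, Finset.sup_insert,
        ← hμ.additive _ _ (by rw [← disjoint_iff]; exact disjoint_sdiff_self_left),
        sdiff_sup_self]

end Measure

/-! ### Pathological submeasures on finite subalgebras -/

section Pathological

variable {A : Type*} [BooleanAlgebra A]

/-- A weight on a finite set is, up to a part where the submeasure `Φ` is small, dominated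
by `Φ`. -/
theorem exists_dominated_off {J : Type*} [Finite J] [DecidableEq J] (Φ : Finset J → ℝ)
    (hΦ0 : Φ ∅ = 0) (hΦ : ∀ s t, Φ (s ∪ t) ≤ Φ s + Φ t) (w : J → ℝ) :
    ∃ I : Finset J, Φ I ≤ ∑ i ∈ I, w i ∧ ∀ t, Disjoint t I → ∑ i ∈ t, w i ≤ Φ t := by
  have := Fintype.ofFinite J
  -- Take `I` maximal with `Φ I ≤ w(I)`. By subadditivity, a `t` disjoint from `I` with `Φ t < w(t)`
  -- could be added to it.
  obtain ⟨I, hI⟩ := (Set.toFinite {I : Finset J | Φ I ≤ ∑ i ∈ I, w i}).exists_maximal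
    ⟨∅, by simp [hΦ0]⟩
  refine ⟨I, hI.1, fun t ht => ?_⟩
  by_contra! hlt
  have hle : I ∪ t ≤ I := hI.2 (y := I ∪ t) (by
    change Φ (I ∪ t) ≤ ∑ i ∈ I ∪ t, w i
    rw [Finset.sum_union ht.symm]
    linarith [hΦ I t, show Φ I ≤ ∑ i ∈ I, w i from hI.1]) Finset.subset_union_left
  have ht0 : t = ∅ := by
    rw [← Finset.disjoint_self_iff_empty]
    exact ht.mono_right (Finset.subset_union_right.trans hle)
  subst ht0
  simp [hΦ0] at hlt

/-- For a pathological submeasure, finitely many instances of additivity suffice to bound the total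
mass of the functions below it. -/
theorem Submeasure.IsPathological.exists_finset {φ : Submeasure A} (hφ : φ.IsPathological) {δ : ℝ}
    (hδ : 0 < δ) : ∃ T : Finset (A × A), ∀ l : A → ℝ, (∀ x, 0 ≤ l x) → (∀ x, l x ≤ φ x) →
      (∀ p ∈ T, p.1 ⊓ p.2 = ⊥ → l (p.1 ⊔ p.2) = l p.1 + l p.2) → l ⊤ < δ := by
  -- `K` is compact by Tychonoff. A member of `K` satisfying all the closed conditions `C p` would
  -- be a non-zero measure below `φ`, so finitely many of them already exclude `K`.
  let K : Set (A → ℝ) := Set.univ.pi (fun x => Icc 0 (φ x)) ∩ {l | δ ≤ l ⊤}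
  have hK : IsCompact K := (isCompact_univ_pi fun x => isCompact_Icc).inter_right
    (isClosed_le continuous_const (continuous_apply _))
  let C : A × A → Set (A → ℝ) := fun p => {l | p.1 ⊓ p.2 = ⊥ → l (p.1 ⊔ p.2) = l p.1 + l p.2}
  have hC : ∀ p, IsClosed (C p) := fun p => by
    by_cases hp : p.1 ⊓ p.2 = ⊥
    · simp only [C, hp, forall_const]
      exact isClosed_eq (by fun_prop) (by fun_prop)
    · simp [C, hp]
  obtain ⟨T, hT⟩ := hK.elim_finite_subfamily_closed C hC (by
    by_contra! hne
    obtain ⟨l, ⟨hl, hδl⟩, hadd⟩ := hne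
    have hadd : ∀ x y, x ⊓ y = ⊥ → l (x ⊔ y) = l x + l y := fun x y =>
      (Set.mem_iInter.1 hadd (x, y) : x ⊓ y = ⊥ → _)
    have hl : ∀ x, 0 ≤ l x ∧ l x ≤ φ x := fun x => hl x (mem_univ x)
    refine hφ ⟨l, ⟨fun x y hxy => ?_, hadd⟩, ?_, fun x => (hl x).2⟩
    · rw [← sup_sdiff_cancel_right hxy, hadd _ _ inf_sdiff_self_right]
      linarith [(hl (y \ x)).1]
    · rintro rfl
      exact absurd hδl (by simpa using hδ))
  refine ⟨T, fun l h0 hle hadd => ?_⟩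
  by_contra! hlt
  refine (Set.eq_empty_iff_forall_notMem.1 hT) l ⟨⟨fun x _ => ⟨h0 x, hle x⟩, hlt⟩, ?_⟩
  simp only [Set.mem_iInter]
  exact hadd

end Pathological

/-! ### Averaging over boxes -/

section Box

variable {J : Type*} [Fintype J] [DecidableEq J]

/-- The integer vectors with entries in `[0, 2n)` on `I` and zero entries elsewhere. -/
noncomputable def box (n : ℕ) (I : Finset J) : Finset (J → ℤ) :=
  Fintype.piFinset fun j => if j ∈ I then Finset.Ico 0 (2 * n : ℤ) else {0}

theorem mem_box {n : ℕ} {I : Finset J} {m : J → ℤ} :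
    m ∈ box n I ↔ (∀ j ∈ I, 0 ≤ m j ∧ m j < 2 * n) ∧ ∀ j ∉ I, m j = 0 := by
  rw [box, Fintype.mem_piFinset]
  constructor
  · intro h
    exact ⟨fun j hj => by simpa [hj] using h j, fun j hj => by simpa [hj] using h j⟩
  · rintro ⟨h1, h2⟩ j
    by_cases hj : j ∈ I
    · simpa [hj] using h1 j hj
    · simpa [hj] using h2 j hj

theorem add_single_mem_box {n : ℕ} {I : Finset J} {m : J → ℤ} (hm : m ∈ box n I) {j : J}
    (hj : j ∈ I) {r : ℤ} (h0 : 0 ≤ m j + r) (h1 : m j + r < 2 * n) :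
    m + Pi.single j r ∈ box n I := by
  rw [mem_box] at hm ⊢
  refine ⟨fun i hi => ?_, fun i hi => ?_⟩
  · by_cases h : i = j
    · subst h; simpa using ⟨h0, h1⟩
    · simpa [h] using hm.1 i hi
  · have : i ≠ j := fun h => hi (h ▸ hj)
    simpa [this] using hm.2 i hi

/-- A set that meets all pairs of points of the box that differ by a given small step in a given
coordinate contains at least a quarter of the box. -/
theorem card_box_le {n : ℕ} {I : Finset J} {j : J} (hj : j ∈ I) {r : ℕ} (hr : r ≤ n)
    (t : Finset (J → ℤ)) (ht : ∀ m ∈ box n I, m + Pi.single j (r : ℤ) ∈ box n I →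
      m ∈ t ∨ m + Pi.single j (r : ℤ) ∈ t) : (box n I).card ≤ 4 * t.card := by
  -- The box is covered by its lower half in direction `j` and a translate of it. The lower half is
  -- covered by `t` and a translate of `t`, as `r ≤ n` keeps `m + r e j` in the box. The two
  -- doublings give the factor 4.
  let lo := (box n I).filter fun m : J → ℤ => m j < n
  have h1 : box n I ⊆ lo ∪ lo.image (· + Pi.single j (n : ℤ)) := by
    intro m hm
    by_cases hmj : m j < n
    · exact Finset.mem_union_left _ (Finset.mem_filter.2 ⟨hm, hmj⟩)
    · have hb := (mem_box.1 hm).1 j hj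
      refine Finset.mem_union_right _ (Finset.mem_image.2
        ⟨m + Pi.single j (-n : ℤ), Finset.mem_filter.2
          ⟨add_single_mem_box hm hj (by lia) (by lia), by simp; lia⟩, ?_⟩)
      rw [add_assoc, ← Pi.single_add]
      simp
  have h2 : lo ⊆ t ∪ t.image (· - Pi.single j (r : ℤ)) := by
    intro m hm
    obtain ⟨hm, hmj⟩ := Finset.mem_filter.1 hm
    have hb := (mem_box.1 hm).1 j hj
    rcases ht m hm (add_single_mem_box hm hj (by lia) (by lia)) with h | h
    · exact Finset.mem_union_left _ h
    · exact Finset.mem_union_right _ (Finset.mem_image.2 ⟨_, h, by simp⟩)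
  have h3 := (Finset.card_le_card h1).trans (Finset.card_union_le _ _)
  have h4 := (Finset.card_le_card h2).trans (Finset.card_union_le _ _)
  have h5 := Finset.card_image_le (s := lo) (f := (· + Pi.single j (n : ℤ)))
  have h6 := Finset.card_image_le (s := t) (f := (· - Pi.single j (r : ℤ)))
  lia

end Box

/-! ### Values of elements of `S(φ, G)` at points -/

section Evaluation

variable {A G : Type*} [BooleanAlgebra A] {φ : Submeasure A} [Group G] [TopologicalSpace G]
  [IsTopologicalGroup G]

/-- The join of all parts of `a` with label in `T`. -/
noncomputable def S.on (a : S φ G) (T : Set G) : A := FinPartition.on (a : FinPartition A G) T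

theorem point_on_iff {ω : BoundedLatticeHom A Prop} {a : S φ G} {T : Set G} :
    ω (a.on T) ↔ evalHom φ ω a ∈ T :=
  FinPartition.point_on_iff

theorem setOf_le_mem_nhds_one (φ : Submeasure A) {V : Set G} (hV : V ∈ 𝓝 1) {ε : ℝ}
    (hε : 0 < ε) : {a : S φ G | φ (a.on Vᶜ) ≤ ε} ∈ 𝓝 (1 : S φ G) :=
  (nhds_one_hasBasis φ G).mem_of_mem (i := (V, ε)) ⟨hV, hε⟩

end Evaluation

/-! ### Escape estimates by averaging over a box -/

section Escape

variable {B : Type*} [BooleanAlgebra B] {μ : B → ℝ} {H : Type*} [Group H] [TopologicalSpace H]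
  [IsTopologicalGroup H] {J : Type*} [Fintype J] [DecidableEq J]

/-- If `σ` maps the box over `I` to elements that take values in `V` up to measure `ε`, and if `σ`
is approximately a homomorphism, then the values of `σ` on the basis vectors are
simultaneously `f`-small up to measure `5 * ε`. -/
theorem measure_sup_le (hμ : IsMeasure μ) {f : H → ℝ} {U V : Set H} {n : ℕ} {η ε κ : ℝ}
    (hV : ∀ x ∈ V, ∀ y ∈ V, ∀ z ∈ V, x⁻¹ * y⁻¹ * z ∈ U) (hn : rootSet n U ⊆ f ⁻¹' Iio η)
    (I : Finset J) (σ : (J → ℤ) → S hμ.toSubmeasure H)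
    (hn0 : 0 < n)
    (hσ : ∀ m ∈ box n I, μ ((σ m).on Vᶜ) ≤ ε)
    (hadd : ∀ p ∈ box n I ×ˢ I ×ˢ Finset.Icc 1 n,
      μ (((σ p.1)⁻¹ * σ (p.1 + Pi.single p.2.1 (p.2.2 : ℤ)) *
        (σ (Pi.single p.2.1 1) ^ p.2.2)⁻¹).on Vᶜ) ≤ κ)
    (hκ : (box n I ×ˢ I ×ˢ Finset.Icc 1 n).card * κ ≤ ε) :
    μ (I.sup fun j => (σ (Pi.single j 1)).on (f ⁻¹' Iio η)ᶜ) ≤ 5 * ε := by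
  classical
  -- `E` collects the points where one of the finitely many approximate relations `σ (m + r e j) ≈ σ
  -- m * σ (e j) ^ r` fails. `D` is the set to be bounded.
  let E := (box n I ×ˢ I ×ˢ Finset.Icc 1 n).sup fun p => S.on
    ((σ p.1)⁻¹ * σ (p.1 + Pi.single p.2.1 (p.2.2 : ℤ)) * (σ (Pi.single p.2.1 1) ^ p.2.2)⁻¹) Vᶜ
  let D := I.sup fun j => (σ (Pi.single j 1)).on (f ⁻¹' Iio η)ᶜ
  have hE : μ E ≤ ε := by
    refine (hμ.toSubmeasure.finset_sup_le _ _).trans ((Finset.sum_le_card_nsmul _ _ κ hadd).trans ?_)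
    rwa [nsmul_eq_mul]
  have hbox : (0 : ℝ) < (box n I).card := by
    have : (0 : J → ℤ) ∈ box n I := mem_box.2 ⟨fun _ _ => by simpa using hn0, fun _ _ => rfl⟩
    exact_mod_cast Finset.card_pos.2 ⟨_, this⟩
  -- At a point of `D \ E`, some `σ (e j)` has a power `r ≤ n` outside `U`. Then `σ m` and `σ (m + r
  -- e j)` cannot both lie in `V`, so a quarter of the box has values outside `V`.
  have hcount := hμ.mul_le_sum_inf (box n I) (fun m => (σ m).on Vᶜ) (D \ E)
    ((box n I).card / 4) (fun ω hω => by
      rw [point_sdiff] at hω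
      obtain ⟨hD, hE⟩ := hω
      obtain ⟨j, hj, hω⟩ := (point_finset_sup ω _ _).1 hD
      rw [point_finset_sup] at hE
      rw [point_on_iff] at hω
      have hroot : evalHom hμ.toSubmeasure ω (σ (Pi.single j 1)) ∉ rootSet n U :=
        fun h => hω (hn h)
      simp only [rootSet, mem_ofPred_eq, not_forall] at hroot
      obtain ⟨r, hr1, hrn, hr⟩ := hroot
      refine ⟨(box n I).filter fun m => ω ((σ m).on Vᶜ), Finset.filter_subset _ _,
        fun m hm => (Finset.mem_filter.1 hm).2, ?_⟩
      have := card_box_le hj hrn ((box n I).filter fun m => ω ((σ m).on Vᶜ))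
        (fun m hm hm' => by
          by_contra! hcon
          refine hr ?_
          have h1 : evalHom hμ.toSubmeasure ω (σ m) ∈ V := by
            by_contra h
            exact hcon.1 (Finset.mem_filter.2 ⟨hm, point_on_iff.2 h⟩)
          have h2 : evalHom hμ.toSubmeasure ω (σ (m + Pi.single j (r : ℤ))) ∈ V := by
            by_contra h
            exact hcon.2 (Finset.mem_filter.2 ⟨hm', point_on_iff.2 h⟩)
          have h3 : evalHom hμ.toSubmeasure ω ((σ m)⁻¹ * σ (m + Pi.single j (r : ℤ)) *
              (σ (Pi.single j 1) ^ r)⁻¹) ∈ V := by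
            by_contra h
            exact hE ⟨(m, j, r), Finset.mem_product.2 ⟨hm, Finset.mem_product.2
              ⟨hj, Finset.mem_Icc.2 ⟨hr1, hrn⟩⟩⟩, point_on_iff.2 h⟩
          -- The product `x⁻¹ * y⁻¹ * z` telescopes to the value of `σ (e j) ^ r`.
          have h4 := hV _ h3 _ h1 _ h2
          rw [map_mul, map_mul, map_inv, map_inv, map_pow] at h4
          convert h4 using 1
          group)
      have h' : ((box n I).card : ℝ) ≤ 4 * ((box n I).filter
        fun m => ω ((σ m).on Vᶜ)).card := by exact_mod_cast this
      linarith)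
  have hsum : ∑ m ∈ box n I, μ ((σ m).on Vᶜ ⊓ (D \ E)) ≤ (box n I).card * ε := by
    rw [← nsmul_eq_mul]
    exact Finset.sum_le_card_nsmul _ _ _ fun m hm => (hμ.monotone inf_le_left).trans (hσ m hm)
  have h4 : μ (D \ E) ≤ 4 * ε := by
    have := hcount.trans hsum
    rw [div_mul_eq_mul_div, div_le_iff₀ (by norm_num), mul_assoc] at this
    linarith [le_of_mul_le_mul_left this hbox]
  have h5 := hμ.inf_add_sdiff D E
  have h6 := hμ.monotone (inf_le_right : D ⊓ E ≤ E)
  change μ D ≤ _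
  linarith

end Escape

/-! ### Approximation of homomorphisms into Raikov completions -/

section Approximation

variable {X : Type*} [Group X] [TopologicalSpace X] [IsTopologicalGroup X]

/-- The canonical homomorphism to the Raikov completion. -/
noncomputable def RaikovCompletion.ιHom : X →* RaikovCompletion X where
  toFun := RaikovCompletion.ι
  map_one' := rfl
  map_mul' := RaikovCompletion.ι_mul

/-- The filter of approximations, by maps to the group, of a map to its completion. -/
def approxFilter {M : Type*} (θ : M → RaikovCompletion X) : Filter (M → X) :=
  Filter.pi fun m => comap RaikovCompletion.ι (𝓝 (θ m))

variable {M : Type*} {θ : M → RaikovCompletion X}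

instance : (approxFilter θ).NeBot :=
  pi_neBot.2 fun m => RaikovCompletion.isDenseInducing_ι.comap_nhds_neBot (θ m)

theorem tendsto_approxFilter (m : M) :
    Tendsto (fun σ : M → X => RaikovCompletion.ιHom (σ m)) (approxFilter θ) (𝓝 (θ m)) :=
  tendsto_comap.comp (tendsto_eval_pi _ m)

/-- The topology of `X` is induced by `ι`, so a relation valid in the completion holds for
approximations up to any identity neighborhood of `X`. -/
theorem eventually_mem_of_tendsto_one {Y : Type*} {l : Filter Y} {u : Y → X}
    (hu : Tendsto (fun y => RaikovCompletion.ιHom (u y)) l (𝓝 1)) {W : Set X}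
    (hW : W ∈ 𝓝 (1 : X)) : ∀ᶠ y in l, u y ∈ W := by
  rw [RaikovCompletion.isDenseInducing_ι.nhds_eq_comap] at hW
  exact (tendsto_comap_iff.2 hu) hW

variable {B : Type*} [BooleanAlgebra B] {μ : B → ℝ} {H : Type*} [Group H] [TopologicalSpace H]
  [IsTopologicalGroup H] {J : Type*} [Fintype J] [DecidableEq J]

/-- The hypotheses of `measure_sup_le` concern finitely many vectors and relations, so they hold
eventually. `η` affects only the box size and the precision `κ`, not the bound. -/
theorem eventually_measure_sup_le (hμ : IsMeasure μ)
    (θ : Multiplicative (J → ℤ) →* L0 hμ.toSubmeasure H) {f : H → ℝ} {U V : Set H}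
    (hU : IsEscapeNhd f U) (hV1 : V ∈ 𝓝 1)
    (hV : ∀ x ∈ V, ∀ y ∈ V, ∀ z ∈ V, x⁻¹ * y⁻¹ * z ∈ U) {ε η : ℝ} (hε : 0 < ε) (hη : 0 < η)
    (I : Finset J)
    (hI : ∀ m : J → ℤ, (∀ j ∉ I, m j = 0) →
      ∀ᶠ σ in approxFilter fun m : J → ℤ => θ (Multiplicative.ofAdd m),
        μ ((σ m).on Vᶜ) ≤ ε) :
    ∀ᶠ σ in approxFilter fun m : J → ℤ => θ (Multiplicative.ofAdd m),
      μ (I.sup fun j => (σ (Pi.single j 1)).on (f ⁻¹' Iio η)ᶜ) ≤ 5 * ε := by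
  obtain ⟨n₀, hn₀⟩ := hU.2 η hη
  -- The successor makes `n` positive, so that the box is non-empty.
  let n := n₀ + 1
  have hn : rootSet n U ⊆ f ⁻¹' Iio η := fun g hg =>
    (hn₀ (show g ∈ rootSet n₀ U from fun k h1 h2 => hg k h1 (by lia))).2
  let N : ℝ := (box n I ×ˢ I ×ˢ Finset.Icc 1 n).card
  have hN : 0 ≤ N := Nat.cast_nonneg _
  -- The budget `ε` is shared among `N` relations; `N = 0` occurs when `I` is empty.
  let κ := ε / (N + 1)
  have hκ : 0 < κ := by positivity
  have h1 := (Filter.eventually_all_finset (box n I)).2 fun m hm => hI m (mem_box.1 hm).2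
  have h2 := (Filter.eventually_all_finset (box n I ×ˢ I ×ˢ Finset.Icc 1 n)).2
    fun p _ => eventually_mem_of_tendsto_one
      (u := fun σ : (J → ℤ) → S hμ.toSubmeasure H => (σ p.1)⁻¹ *
        σ (p.1 + Pi.single p.2.1 (p.2.2 : ℤ)) * (σ (Pi.single p.2.1 1) ^ p.2.2)⁻¹)
      (l := approxFilter fun m : J → ℤ => θ (Multiplicative.ofAdd m)) (by
        have h := ((tendsto_approxFilter (θ := fun m : J → ℤ => θ (Multiplicative.ofAdd m))
          p.1).inv.mul (tendsto_approxFilter (p.1 + Pi.single p.2.1 (p.2.2 : ℤ)))).mul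
          ((tendsto_approxFilter (Pi.single p.2.1 1)).pow p.2.2).inv
        simp only [← map_inv, ← map_mul, ← map_pow] at h
        convert h using 2
        rw [← map_one θ]
        congr 1
        rw [← ofAdd_nsmul, ← ofAdd_neg, ← ofAdd_neg, ← ofAdd_add, ← ofAdd_add, ← ofAdd_zero]
        congr 1
        rw [← Pi.single_smul]
        simp)
      (setOf_le_mem_nhds_one hμ.toSubmeasure hV1 hκ)
  filter_upwards [h1, h2] with σ h1 h2
  refine measure_sup_le hμ hV hn I σ (Nat.succ_pos _) h1 h2 ?_
  change N * (ε / (N + 1)) ≤ ε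
  rw [mul_div_assoc', div_le_iff₀ (by positivity)]
  nlinarith

end Approximation

/-! ### Homomorphisms from `L⁰(φ, G)` to `L⁰(μ, H)` -/

section Main

theorem IsLengthFunction.list_prod_le {H : Type*} [Group H] {f : H → ℝ}
    (hf : IsLengthFunction f) (l : List H) : f l.prod ≤ (l.map f).sum := by
  induction l with
  | nil => simp [hf.map_one]
  | cons x l ih =>
    simp only [List.prod_cons, List.map_cons, List.sum_cons]
    linarith [hf.map_mul_le x l.prod]

variable {A B G H : Type*} [BooleanAlgebra A] [BooleanAlgebra B]
  [Group G] [TopologicalSpace G] [IsTopologicalGroup G]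
  [Group H] [TopologicalSpace H] [IsTopologicalGroup H] {φ : Submeasure A} {μ : B → ℝ}

/-- The vector 1 is the sum of the basis vectors, so `σ 1` is the product of their images times an
error. Where all of these have length below `η`, the length of `σ 1` is below `(|J| + 1) * η ≤ 1`;
`ε` accounts for the set where the error is large. -/
theorem eventually_measure_one_le {J : Type*} [Fintype J] [DecidableEq J] (hμ : IsMeasure μ)
    (θ : Multiplicative (J → ℤ) →* L0 hμ.toSubmeasure H) {f : H → ℝ} (hf : IsLengthFunction f)
    (hfc : Continuous f) {ε η : ℝ} (hε : 0 < ε) (hη : 0 < η) (hη1 : (Fintype.card J + 1) * η ≤ 1) :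
    ∀ᶠ σ in approxFilter fun m : J → ℤ => θ (Multiplicative.ofAdd m),
      μ ((σ 1).on (f ⁻¹' Iio 1)ᶜ) ≤
        μ (Finset.univ.sup fun j => (σ (Pi.single j 1)).on (f ⁻¹' Iio η)ᶜ) + ε := by
  -- `H` need not be commutative, so the product follows a fixed enumeration.
  let l : List J := Finset.univ.toList
  have hW : f ⁻¹' Iio η ∈ 𝓝 (1 : H) :=
    hfc.continuousAt.preimage_mem_nhds (Iio_mem_nhds (by rwa [hf.map_one]))
  have h := eventually_mem_of_tendsto_one
      (u := fun σ : (J → ℤ) → S hμ.toSubmeasure H =>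
        (l.map fun j => σ (Pi.single j 1)).prod⁻¹ * σ 1)
      (l := approxFilter fun m : J → ℤ => θ (Multiplicative.ofAdd m)) (by
        have h := (tendsto_list_prod l fun j _ => tendsto_approxFilter
          (θ := fun m : J → ℤ => θ (Multiplicative.ofAdd m)) (Pi.single j 1)).inv.mul
          (tendsto_approxFilter (θ := fun m : J → ℤ => θ (Multiplicative.ofAdd m)) 1)
        convert h using 2
        · rw [map_mul, map_inv, map_list_prod, List.map_map]
          rfl
        · rw [show (l.map fun j => θ (Multiplicative.ofAdd (Pi.single j 1))).prod =
            θ (Multiplicative.ofAdd 1) from ?_, inv_mul_cancel]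
          rw [show (fun j => θ (Multiplicative.ofAdd (Pi.single j 1))) =
            θ ∘ fun j => Multiplicative.ofAdd (Pi.single j 1) from rfl, ← List.map_map,
            ← map_list_prod, Finset.prod_map_toList, ← ofAdd_sum]
          congr 2
          exact Finset.univ_sum_single (1 : J → ℤ))
      (setOf_le_mem_nhds_one hμ.toSubmeasure hW hε)
  filter_upwards [h] with σ hσ
  have hσ : μ (S.on ((l.map fun j => σ (Pi.single j 1)).prod⁻¹ * σ 1) (f ⁻¹' Iio η)ᶜ) ≤ ε := hσ
  refine le_trans (hμ.monotone ?_) ((hμ.toSubmeasure.subadditive _ _).trans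
    (add_le_add_right hσ _))
  refine le_of_points fun ω hω => ?_
  rw [point_sup, point_finset_sup]
  by_contra! hcon
  obtain ⟨h1, h2⟩ := hcon
  have h1 : ∀ j, f (evalHom hμ.toSubmeasure ω (σ (Pi.single j 1))) < η := fun j => by
    simpa [point_on_iff] using h1 j (Finset.mem_univ j)
  have h2 : f (evalHom hμ.toSubmeasure ω ((l.map fun j => σ (Pi.single j 1)).prod⁻¹ * σ 1)) < η := by
    rwa [point_on_iff, mem_compl_iff, not_not] at h2
  have h3 := hf.map_mul_le (evalHom hμ.toSubmeasure ω (l.map fun j => σ (Pi.single j 1)).prod)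
    (evalHom hμ.toSubmeasure ω ((l.map fun j => σ (Pi.single j 1)).prod⁻¹ * σ 1))
  rw [← map_mul, mul_inv_cancel_left, map_list_prod, List.map_map] at h3
  have h4 := hf.list_prod_le
    (l.map (evalHom hμ.toSubmeasure ω ∘ fun j => σ (Pi.single j 1)))
  have h5 := List.sum_le_card_nsmul
    ((l.map (evalHom hμ.toSubmeasure ω ∘ fun j => σ (Pi.single j 1))).map f) η (by
      simp only [List.map_map, List.mem_map]
      rintro _ ⟨j, -, rfl⟩
      exact (h1 j).le)
  rw [List.length_map, List.length_map, Finset.length_toList, Finset.card_univ,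
    nsmul_eq_mul] at h5
  rw [point_on_iff] at hω
  refine hω ?_
  change f _ < 1
  linarith

/-- A family of sets, indexed by the parts of a partition that witnesses pathologicality of `φ`,
has a small union if its subfamilies over `φ`-small sets have. -/
theorem measure_sup_le_of_witness (hμ : IsMeasure μ) {c δ ε : ℝ} (hc : 0 < c)
    (hcδ : c * μ ⊤ ≤ δ) {T : Finset (A × A)}
    (hT : ∀ l : A → ℝ, (∀ x, 0 ≤ l x) → (∀ x, l x ≤ φ x) →
      (∀ p ∈ T, p.1 ⊓ p.2 = ⊥ → l (p.1 ⊔ p.2) = l p.1 + l p.2) → l ⊤ < c * ε)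
    {P : Finpartition (⊤ : A)}
    (hP : ∀ p ∈ T, ∀ j ∈ P.parts, (j ≤ p.1 ∨ Disjoint j p.1) ∧ (j ≤ p.2 ∨ Disjoint j p.2))
    (d : P.parts → B)
    (hd : ∀ I : Finset P.parts, φ (I.sup fun j => (j : A)) ≤ δ → μ (I.sup d) ≤ 5 * ε) :
    μ (Finset.univ.sup d) ≤ 6 * ε := by
  classical
  obtain ⟨w, hw0, hw, hw1⟩ := hμ.exists_weights Finset.univ d
  -- The scaling by `c` makes `I` `φ`-small: `φ(⋁ I) ≤ c * w(I) ≤ c * μ ⊤ ≤ δ`.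
  obtain ⟨I, hI, hoff⟩ := exists_dominated_off
    (fun I : Finset P.parts => φ (I.sup fun j => (j : A))) (by simp [φ.map_bot])
    (fun s t => by rw [Finset.sup_union]; exact φ.subadditive _ _) (fun j => c * w j)
  simp only [← Finset.mul_sum] at hI hoff
  have hIw : ∑ j ∈ I, w j ≤ 5 * ε := by
    refine (hw I (Finset.subset_univ _)).trans (hd I (hI.trans (le_trans ?_ hcδ)))
    exact mul_le_mul_of_nonneg_left ((hw I (Finset.subset_univ _)).trans (hμ.monotone le_top)) hc.le
  -- The function `x ↦ c * w(N x)` lies below `φ`. It is additive on the disjoint pairs in `T`: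
  -- since `P` decides both entries, a part below their join lies below exactly one of them. Hence
  -- `w(Iᶜ) < ε`, which with `w(I) ≤ 5 * ε` gives `6 * ε`.
  let N : A → Finset P.parts := fun x => Iᶜ.filter fun j => (j : A) ≤ x
  have hl := hT (fun x => c * ∑ j ∈ N x, w j)
    (fun x => mul_nonneg hc.le (Finset.sum_nonneg fun j _ => hw0 j))
    (fun x => (hoff (N x) (disjoint_compl_left.mono_left (Finset.filter_subset _ _))).trans
      (φ.monotone (Finset.sup_le fun j hj => (Finset.mem_filter.1 hj).2)))
    (fun p hp hdis => by
      rw [← mul_add, ← Finset.sum_union]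
      · congr 1
        refine Finset.sum_congr ?_ fun _ _ => rfl
        rw [← Finset.filter_or]
        refine Finset.filter_congr fun j _ => ⟨fun h => ?_, fun h => ?_⟩
        · obtain ⟨h1, h2⟩ := hP p hp j j.2
          by_contra! hcon
          have := (h1.resolve_left hcon.1).sup_right (h2.resolve_left hcon.2)
          exact P.ne_bot j.2 (disjoint_self.1 (this.mono_right h))
        · exact h.elim (fun h => h.trans le_sup_left) fun h => h.trans le_sup_right
      · refine Finset.disjoint_filter.2 fun j _ h1 h2 => P.ne_bot j.2 ?_
        exact le_bot_iff.1 (hdis ▸ le_inf h1 h2))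
  have hN : N ⊤ = Iᶜ := Finset.filter_true_of_mem fun _ _ => le_top
  simp only [hN] at hl
  have := lt_of_mul_lt_mul_left hl hc.le
  rw [← hw1, ← Finset.sum_add_sum_compl I w]
  linarith

/-- A homomorphism from `ℤ ^ P` to `S(φ, G)`, given by the labels `k`. -/
noncomputable def partsHom (φ : Submeasure A) {P : Finpartition (⊤ : A)} (k : P.parts → G) :
    Multiplicative (P.parts → ℤ) →* S φ G :=
  -- Only powers of the single element `k j` occur on the part `j`, so `G` need not be commutative.
  MonoidHom.mk' (fun m => (ofParts P fun j => k j ^ m.toAdd j : FinPartition A G)) fun m n => by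
    refine Eq.trans ?_ (ofParts_mul (fun j => k j ^ m.toAdd j) fun j => k j ^ n.toAdd j)
    congr 1
    funext j
    exact zpow_add _ _ _

theorem map_ι_eq_one (hH : HasEscapeProperty H) (hφ : φ.IsPathological) (hμ : IsMeasure μ)
    (π : L0 φ G →* L0 hμ.toSubmeasure H) (hπ : Continuous π) (a : S φ G) :
    π (RaikovCompletion.ι a) = 1 := by
  classical
  by_contra hne
  -- A closed neighborhood is chosen because only approximations to `π (ι a)` will be shown to lie
  -- in it.
  obtain ⟨O, ⟨hO1, hOc⟩, hO⟩ := (closed_nhds_basis (1 : L0 hμ.toSubmeasure H)).mem_iff.1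
    (isOpen_compl_singleton.mem_nhds (Ne.symm hne) : {π (RaikovCompletion.ι a)}ᶜ ∈ 𝓝 1)
  obtain ⟨⟨V₀, ε₀⟩, ⟨hV₀, hε₀⟩, hVO⟩ := (nhds_one_hasBasis hμ.toSubmeasure H).mem_iff.1
    (RaikovCompletion.continuous_ι.continuousAt.preimage_mem_nhds
      (by rwa [RaikovCompletion.ι_one]))
  obtain ⟨f, hf, hfV⟩ := hH.mem_iff.1 hV₀
  obtain ⟨U, hU⟩ := hf.exists_nhd
  have hlen := hf.isLengthFunction
  have hcont : Tendsto (fun p : H × H × H => p.1⁻¹ * p.2.1⁻¹ * p.2.2) (𝓝 1 ×ˢ 𝓝 1 ×ˢ 𝓝 1)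
      (𝓝 1) := by
    have h : Continuous fun p : H × H × H => p.1⁻¹ * p.2.1⁻¹ * p.2.2 := by fun_prop
    simpa [nhds_prod_eq] using h.tendsto (1, 1, 1)
  obtain ⟨V₁, hV₁, W, hW, h₁⟩ := mem_prod_iff.1 (hcont hU.1)
  obtain ⟨V₂, hV₂, V₃, hV₃, h₂⟩ := mem_prod_iff.1 hW
  let V := V₁ ∩ (V₂ ∩ V₃)
  have hV1 : V ∈ 𝓝 (1 : H) := inter_mem hV₁ (inter_mem hV₂ hV₃)
  have hV : ∀ x ∈ V, ∀ y ∈ V, ∀ z ∈ V, x⁻¹ * y⁻¹ * z ∈ U := fun x hx y hy z hz =>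
    h₁ (show ((x, y, z) : H × H × H) ∈ V₁ ×ˢ W from
      ⟨hx.1, h₂ (show ((y, z) : H × H) ∈ V₂ ×ˢ V₃ from ⟨hy.2.1, hz.2.2⟩)⟩)
  -- `6 * ε` is for the basis vectors and `ε` for passing to their product.
  let ε := ε₀ / 7
  have hε : 0 < ε := by have : 0 < ε₀ := hε₀; positivity
  have hnear := setOf_le_mem_nhds_one hμ.toSubmeasure hV1 hε
  rw [RaikovCompletion.isDenseInducing_ι.nhds_eq_comap] at hnear
  obtain ⟨N, hN1, hN⟩ := hnear
  have hpre : (fun x : S φ G => π (RaikovCompletion.ι x)) ⁻¹' interior N ∈ 𝓝 1 := by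
    refine (hπ.comp RaikovCompletion.continuous_ι).continuousAt.preimage_mem_nhds ?_
    rw [Function.comp_apply, RaikovCompletion.ι_one, map_one]
    exact interior_mem_nhds.2 hN1
  obtain ⟨⟨V', δ⟩, ⟨hV', hδ⟩, hδN⟩ := (nhds_one_hasBasis φ G).mem_iff.1 hpre
  have hδ : 0 < δ := hδ
  have hV' : V' ∈ 𝓝 (1 : G) := hV'
  have hμ0 := hμ.nonneg ⊤
  let c := δ / (μ ⊤ + 1)
  have hc : 0 < c := by positivity
  have hcδ : c * μ ⊤ ≤ δ := by
    rw [div_mul_eq_mul_div, div_le_iff₀ (by positivity)]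
    nlinarith
  obtain ⟨T, hT⟩ := hφ.exists_finset (mul_pos hc hε)
  let a₀ : FinPartition A G := a
  obtain ⟨P, hP⟩ := exists_finpartition_decides
    (T.image Prod.fst ∪ T.image Prod.snd ∪ a₀.support.image a₀)
  obtain ⟨k, hk⟩ := exists_ofParts_eq (P := P) a₀ fun g j hj => by
    by_cases hg : a₀ g = ⊥
    · rw [hg]; exact Or.inr disjoint_bot_right
    · exact hP _ (Finset.mem_union_right _
        (Finset.mem_image_of_mem _ (FinPartition.mem_support.2 hg))) j hj
  let θ : Multiplicative (P.parts → ℤ) →* L0 hμ.toSubmeasure H :=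
    (π.comp RaikovCompletion.ιHom).comp (partsHom φ k)
  have hθ1 : θ (Multiplicative.ofAdd 1) = π (RaikovCompletion.ι a) := by
    refine congrArg (fun x : S φ G => π (RaikovCompletion.ι x)) (Eq.trans ?_ hk)
    change ofParts P _ = _
    simp
  let η : ℝ := 1 / (Fintype.card P.parts + 1)
  have hη : 0 < η := by positivity
  have hsmall : ∀ I : Finset P.parts, φ (I.sup fun j => (j : A)) ≤ δ →
      ∀ᶠ σ in approxFilter fun m : P.parts → ℤ => θ (Multiplicative.ofAdd m),
        μ (I.sup fun j => (σ (Pi.single j 1)).on (f ⁻¹' Iio η)ᶜ) ≤ 5 * ε := by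
    intro I hI
    refine eventually_measure_sup_le hμ θ hU hV1 hV hε hη I fun m hm => ?_
    -- For `m` supported on `I`, the labels `k j ^ m j` are trivial off the `φ`-small union of `I`.
    have hθN : θ (Multiplicative.ofAdd m) ∈ interior N := by
      refine hδN (a := partsHom φ k (Multiplicative.ofAdd m)) (le_trans (φ.monotone ?_) hI)
      refine le_of_points fun ω hω => ?_
      rw [point_finset_sup]
      refine ⟨partAt P ω, ?_, point_part_iff.2 rfl⟩
      by_contra hj
      refine (FinPartition.point_on_iff.1 hω : _ ∉ V') ?_
      refine (?_ : (ofParts P fun j => k j ^ m j).label ω ∈ V')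
      rw [label_ofParts, hm _ hj, zpow_zero]
      exact mem_of_mem_nhds hV'
    filter_upwards [(tendsto_approxFilter (θ := fun m : P.parts → ℤ =>
      θ (Multiplicative.ofAdd m)) m) (isOpen_interior.mem_nhds hθN)] with σ hσ
    exact hN (interior_subset (s := N) hσ)
  -- The set `I` to which the bound is applied depends on `σ`. There are finitely many candidates,
  -- so one `σ` can serve all of them.
  have hall := Filter.eventually_all.2 fun I : Finset P.parts =>
    Filter.eventually_imp_distrib_left.2 (hsmall I)
  have hone := eventually_measure_one_le hμ θ hlen hf.continuous hε hη
    (mul_one_div_cancel (by positivity)).le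
  have hmem : ∀ᶠ σ in approxFilter fun m : P.parts → ℤ => θ (Multiplicative.ofAdd m),
      RaikovCompletion.ιHom (σ 1) ∈ O := by
    filter_upwards [hall, hone] with σ hσ hσ1
    refine hVO (?_ : μ (S.on (σ 1) V₀ᶜ) ≤ ε₀)
    have h6 := measure_sup_le_of_witness hμ hc hcδ hT
      (fun p hp j hj =>
        ⟨hP _ (Finset.mem_union_left _ (Finset.mem_union_left _ (Finset.mem_image_of_mem _ hp))) j hj,
          hP _ (Finset.mem_union_left _ (Finset.mem_union_right _ (Finset.mem_image_of_mem _ hp))) j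
            hj⟩) _ hσ
    have hle : (σ 1).on V₀ᶜ ≤ (σ 1).on (f ⁻¹' Iio 1)ᶜ := le_of_points fun ω hω => by
      rw [point_on_iff] at hω ⊢
      exact fun h => hω (hfV ⟨hlen.nonneg _, h⟩)
    have := hμ.monotone hle
    have : 7 * ε = ε₀ := by simp only [ε]; ring
    linarith
  have := hOc.mem_of_tendsto (tendsto_approxFilter
    (θ := fun m : P.parts → ℤ => θ (Multiplicative.ofAdd m)) 1) hmem
  rw [hθ1] at this
  exact hO this rfl

end Main

end LZero

theorem theoremB {A B G H : Type*} [BooleanAlgebra A] [BooleanAlgebra B]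
    [Group G] [TopologicalSpace G] [IsTopologicalGroup G]
    [Group H] [TopologicalSpace H] [IsTopologicalGroup H]
    (hH : LZero.HasEscapeProperty H)
    (φ : LZero.Submeasure A) (hφ : φ.IsPathological)
    (μ : B → ℝ) (hμ : LZero.IsMeasure μ)
    (π : LZero.L0 φ G →* LZero.L0 hμ.toSubmeasure H) (hπ : Continuous π) :
    ∀ x : LZero.L0 φ G, π x = 1 := fun x =>
  -- The target is Hausdorff and `S(φ, G)` has dense image in the source.
  isClosed_property LZero.RaikovCompletion.isDenseInducing_ι.dense
    (isClosed_eq hπ continuous_const)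
    (LZero.map_ι_eq_one hH hφ hμ π hπ) x
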